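/- Let $\mathbb{F}$ be a field, let $N \ge 1$ and $d \ge 0$ be integers, let $E = \mathbb{F}^2$ be the natural representation of $\mathrm{GL}_2(\mathbb{F})$, and fix a basis $X, Y$ of $E$. For $c \ge 0$ the symmetric power $\mathrm{Sym}^c E$ (the degree $c$ part of the symmetric algebra of $E$) has the basis $X^{c-i}Y^i$, $0 \le i \le c$. For a vector space $V$ let $$\Delta^{(2,1^{N-1})} V = \ker\bigl(\mu_N : \textstyle\bigwedge^N V \otimes V \to \bigwedge^{N+1} V\bigr), \qquad \mu_N(v_1 \wedge \cdots \wedge v_N \otimes w) = v_1 \wedge \cdots \wedge v_N \wedge w ;$$ if $V$ is a representation of a group, then $\Delta^{(2,1^{N-1})} V$ is a subrepresentation of $\bigwedge^N V \otimes V$. Let $\det$ be the one-dimensional determinant representation of $\mathrm{GL}_2(\mathbb{F})$. For a tuple $\mathbf{i} = (i_1, \ldots, i_r)$ with entries in $\{0, \ldots, c\}$ put $|\mathbf{i}| = i_1 + \cdots + i_r$ and $F^{(c)}_\wedge(\mathbf{i}) = X^{c-i_1}Y^{i_1} \wedge \cdots \wedge X^{c-i_r}Y^{i_r} \in \bigwedge^r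 \mathrm{Sym}^c E$. Let $$\phi : \mathrm{Sym}^{N-1} E \otimes \textstyle\bigwedge^{N+1} \mathrm{Sym}^{d+1} E \to \bigwedge^N \mathrm{Sym}^d E \otimes \mathrm{Sym}^d E$$ be the linear map defined on the canonical basis by $$\phi\bigl(X^{N-1-s}Y^s \otimes F^{(d+1)}_\wedge(\mathbf{k})\bigr) = \sum_{\mathbf{i} \in [k_1,k_2) \times \cdots \times [k_N, k_{N+1})} F^{(d)}_\wedge(\mathbf{i}) \otimes X^{d-j(\mathbf{i})}Y^{j(\mathbf{i})}, \qquad j(\mathbf{i}) = s + |\mathbf{k}| - N - |\mathbf{i}|,$$ for $0 \le s \le N-1$ and $0 \le k_1 < \cdots < k_{N+1} \le d+1$, where $[a,b) = \{a, a+1, \ldots, b-1\}$ (one has $0 \le j(\mathbf{i}) \le d$ for every $\mathbf{i}$ in the sum). Then the image of $\phi$ is contained in $\Delta^{(2,1^{N-1})} \mathrm{Sym}^d E$, and $\phi$ (that is, $x \mapsto 1 \otimes \phi(x)$) is an isomorphism of representations of $\mathrm{GL}_2(\mathbb{F})$ $$\mathrm{Sym}^{N-1} E \otimes \textstyle\bigwedge^{N+1}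 \mathrm{Sym}^{d+1} E \;\cong\; \det^N \otimes\, \Delta^{(2,1^{N-1})} \mathrm{Sym}^d E .$$ -/

import Mathlib

open scoped TensorProduct ExteriorAlgebra MatrixGroups

noncomputable section

namespace Plethysm

universe u v w

section SymmetricPower

variable (F : Type u) [Field F]

/-- The symmetric power `Sym^r V`: the degree `r` part of the symmetric algebra of `V`
(the quotient of the tensor algebra by `x ⊗ y - y ⊗ x`), that is, the span of the `r`-fold
products of vectors of `V`. -/
abbrev SymPow (r : ℕ) (V : Type v) [AddCommGroup V] [Module F V] :
    Submodule F (SymmetricAlgebra F V) :=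
  LinearMap.range (SymmetricAlgebra.ι F V) ^ r

variable {F} {V : Type v} [AddCommGroup V] [Module F V] {W : Type w} [AddCommGroup W] [Module F W]

theorem symMap_mem (r : ℕ) (f : V →ₗ[F] W) (x : SymmetricAlgebra F V) (hx : x ∈ SymPow F r V) :
    (SymmetricAlgebra.lift (SymmetricAlgebra.ι F W ∘ₗ f)).toLinearMap x ∈ SymPow F r W := by
  have h := Submodule.mem_map_of_mem
    (f := (SymmetricAlgebra.lift (SymmetricAlgebra.ι F W ∘ₗ f)).toLinearMap) hx
  rw [Submodule.map_pow] at h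
  have hle : (LinearMap.range (SymmetricAlgebra.ι F V)).map
      (SymmetricAlgebra.lift (SymmetricAlgebra.ι F W ∘ₗ f)).toLinearMap ≤
        LinearMap.range (SymmetricAlgebra.ι F W) := by
    rintro _ ⟨_, ⟨v, rfl⟩, rfl⟩
    exact ⟨f v, by simp⟩
  exact pow_le_pow_left' hle r h

/-- Functoriality of `Sym^r`: the linear map with `v₁ ⋯ v_r ↦ f v₁ ⋯ f v_r`. -/
def symMap (r : ℕ) (f : V →ₗ[F] W) : SymPow F r V →ₗ[F] SymPow F r W :=
  LinearMap.restrict (SymmetricAlgebra.lift (SymmetricAlgebra.ι F W ∘ₗ f)).toLinearMap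
    (symMap_mem r f)

/-- The representation `Sym^r V` attached to a representation `V`. -/
def symRep {G : Type w} [Monoid G] (r : ℕ) (ρ : Representation F G V) :
    Representation F G (SymPow F r V) where
  toFun g := symMap r (ρ g)
  map_one' := by
    ext x
    have h : SymmetricAlgebra.lift (SymmetricAlgebra.ι F V ∘ₗ (1 : Module.End F V)) =
        AlgHom.id F _ := by
      ext v; simp
    rw [map_one]
    change SymmetricAlgebra.lift (SymmetricAlgebra.ι F V ∘ₗ (1 : Module.End F V)) x.1 = x.1
    rw [h]; rfl
  map_mul' g g' := by
    ext x
    have h : SymmetricAlgebra.lift (SymmetricAlgebra.ι F V ∘ₗ (ρ g * ρ g')) =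
        (SymmetricAlgebra.lift (SymmetricAlgebra.ι F V ∘ₗ ρ g)).comp
          (SymmetricAlgebra.lift (SymmetricAlgebra.ι F V ∘ₗ ρ g')) := by
      ext v; simp
    rw [map_mul]
    change SymmetricAlgebra.lift (SymmetricAlgebra.ι F V ∘ₗ (ρ g * ρ g')) x.1 = _
    rw [h]; rfl

end SymmetricPower

section ExteriorPower

variable {F : Type u} [Field F] {V : Type v} [AddCommGroup V] [Module F V]

/-- The representation `⋀^r V` attached to a representation `V`. -/
def extRep {G : Type w} [Monoid G] (r : ℕ) (ρ : Representation F G V) :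
    Representation F G (⋀[F]^r V) where
  toFun g := exteriorPower.map r (ρ g)
  map_one' := by rw [map_one]; exact exteriorPower.map_id
  map_mul' g g' := by rw [map_mul]; exact exteriorPower.map_comp _ _

variable (F V)

theorem wedge_mem (N : ℕ) (x : ⋀[F]^N V) (v : V) :
    (x : ExteriorAlgebra F V) * ExteriorAlgebra.ι F v ∈ ⋀[F]^(N + 1) V := by
  change _ ∈ LinearMap.range (ExteriorAlgebra.ι F (M := V)) ^ (N + 1)
  rw [pow_succ]
  exact Submodule.mul_mem_mul x.2 ⟨v, rfl⟩

/-- The multiplication map `μ_N : ⋀^N V ⊗ V → ⋀^(N+1) V`,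
`v₁ ∧ ⋯ ∧ v_N ⊗ w ↦ v₁ ∧ ⋯ ∧ v_N ∧ w`. -/
def mu (N : ℕ) : (⋀[F]^N V) ⊗[F] V →ₗ[F] ⋀[F]^(N + 1) V :=
  TensorProduct.lift <| LinearMap.mk₂ F
    (fun x v => ⟨(x : ExteriorAlgebra F V) * ExteriorAlgebra.ι F v, wedge_mem F V N x v⟩)
    (fun x y v => Subtype.ext (by simp [add_mul]))
    (fun c x v => Subtype.ext (by simp))
    (fun x v w => Subtype.ext (by simp [mul_add]))
    (fun c x v => Subtype.ext (by simp))

/-- The Schur functor `Δ^(2,1^(N-1))` on vector spaces: the kernel of `μ_N`. -/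
def Delta (N : ℕ) : Submodule F ((⋀[F]^N V) ⊗[F] V) :=
  LinearMap.ker (mu F V N)

variable {F V}

theorem mu_natural (N : ℕ) (f : V →ₗ[F] V) :
    mu F V N ∘ₗ TensorProduct.map (exteriorPower.map N f) f =
      exteriorPower.map (N + 1) f ∘ₗ mu F V N := by
  have key : ∀ (n : ℕ) (y : ⋀[F]^n V),
      (exteriorPower.map n f y : ExteriorAlgebra F V) = ExteriorAlgebra.map f y := by
    intro n y
    have : (⋀[F]^n V).subtype ∘ₗ exteriorPower.map n f =
        (ExteriorAlgebra.map f).toLinearMap ∘ₗ (⋀[F]^n V).subtype := by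
      ext v
      simp [exteriorPower.map_apply_ιMulti]
    exact LinearMap.congr_fun this y
  refine TensorProduct.ext' fun x v => Subtype.ext ?_
  simp [mu, key]

theorem Delta_le_comap {G : Type w} [Monoid G] (N : ℕ) (ρ : Representation F G V) (g : G) :
    Delta F V N ≤ (Delta F V N).comap (((extRep N ρ).tprod ρ) g) := by
  intro x hx
  have h := LinearMap.congr_fun (mu_natural N (ρ g)) x
  have hx' : mu F V N x = 0 := hx
  change mu F V N (TensorProduct.map (exteriorPower.map N (ρ g)) (ρ g) x) = 0
  simpa [hx'] using h

/-- The representation `Δ^(2,1^(N-1)) V` attached to a representation `V`. -/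
def deltaRep {G : Type w} [Monoid G] (N : ℕ) (ρ : Representation F G V) :
    Representation F G (Delta F V N) :=
  ((extRep N ρ).tprod ρ).subrepresentation (Delta F V N) (Delta_le_comap N ρ)

end ExteriorPower

section GL2

variable (F : Type u) [Field F]

/-- The natural representation `E = F²` of `GL₂(F)`. -/
def natRep : Representation F (GL (Fin 2) F) (Fin 2 → F) where
  toFun g := Matrix.mulVecLin (g : Matrix (Fin 2) (Fin 2) F)
  map_one' := by simp; rfl
  map_mul' g h := by simp [Matrix.mulVecLin_mul]; rfl

/-- The one-dimensional representation `det^N` of `GL₂(F)`. -/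
def detRep (N : ℕ) : Representation F (GL (Fin 2) F) F where
  toFun g := (Matrix.det (g : Matrix (Fin 2) (Fin 2) F) ^ N) • LinearMap.id
  map_one' := by simp; rfl
  map_mul' g h := by
    ext; simp [mul_pow, mul_comm]

end GL2

section Phi

variable {F : Type u} [Field F] {E : Type v} [AddCommGroup E] [Module F E]
  (b : Module.Basis (Fin 2) F E)

theorem monomial_mem {c i : ℕ} (h : i ≤ c) :
    SymmetricAlgebra.ι F E (b 0) ^ (c - i) * SymmetricAlgebra.ι F E (b 1) ^ i ∈ SymPow F c E := by
  have := Submodule.mul_mem_mul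
    (Submodule.pow_mem_pow (LinearMap.range (SymmetricAlgebra.ι F E)) ⟨b 0, rfl⟩ (c - i))
    (Submodule.pow_mem_pow (LinearMap.range (SymmetricAlgebra.ι F E)) ⟨b 1, rfl⟩ i)
  rwa [← pow_add, Nat.sub_add_cancel h] at this

/-- The monomial `X^(c-i) Y^i` in `Sym^c E` for `0 ≤ i ≤ c`, where `X = b 0`, `Y = b 1` is the
chosen basis of `E`. (The value for `i > c` is set to `0` and never matters, see
`exponent_le`.) -/
def monomial (c i : ℕ) : SymPow F c E :=
  if h : i ≤ c then
    ⟨SymmetricAlgebra.ι F E (b 0) ^ (c - i) * SymmetricAlgebra.ι F E (b 1) ^ i, monomial_mem b h⟩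
  else 0

theorem monomial_linearIndependent (c : ℕ) :
    LinearIndependent F (fun i : Fin (c + 1) => monomial b c i) := by
  have h2 : (SymPow F c E).subtype ∘ (fun i : Fin (c + 1) => monomial b c i) =
      b.symmetricAlgebra ∘ (fun i : Fin (c + 1) =>
        Finsupp.single (0 : Fin 2) (c - (i : ℕ)) + Finsupp.single (1 : Fin 2) (i : ℕ)) := by
    funext i
    have hi : (i : ℕ) ≤ c := Nat.lt_succ_iff.1 i.2
    simp only [Function.comp, monomial, hi, dif_pos, Submodule.subtype_apply,
      Module.Basis.symmetricAlgebra, Module.Basis.map_apply, MvPolynomial.coe_basisMonomials]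
    change _ = (SymmetricAlgebra.equivMvPolynomial b).symm _
    rw [AlgEquiv.eq_symm_apply, map_mul, map_pow, map_pow,
      SymmetricAlgebra.equivMvPolynomial_ι_apply, SymmetricAlgebra.equivMvPolynomial_ι_apply,
      MvPolynomial.X_pow_eq_monomial, MvPolynomial.X_pow_eq_monomial, MvPolynomial.monomial_mul,
      one_mul]
  refine LinearIndependent.of_comp (SymPow F c E).subtype ?_
  rw [h2]
  refine b.symmetricAlgebra.linearIndependent.comp _ fun i j hij => ?_
  have := DFunLike.congr_fun hij 1
  simpa [Fin.ext_iff] using this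

open scoped Pointwise in
theorem monomial_span (c : ℕ) :
    ⊤ ≤ Submodule.span F (Set.range (fun i : Fin (c + 1) => monomial b c i)) := by
  have hr : LinearMap.range (SymmetricAlgebra.ι F E) =
      Submodule.span F {SymmetricAlgebra.ι F E (b 0), SymmetricAlgebra.ι F E (b 1)} := by
    rw [LinearMap.range_eq_map, ← b.span_eq, Submodule.map_span]
    congr 1
    ext x
    simp [eq_comm]
  have hs : ∀ (n : ℕ) (x : SymmetricAlgebra F E),
      x ∈ ({SymmetricAlgebra.ι F E (b 0), SymmetricAlgebra.ι F E (b 1)} :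
        Set (SymmetricAlgebra F E)) ^ n →
      ∃ i, i ≤ n ∧
        x = SymmetricAlgebra.ι F E (b 0) ^ (n - i) * SymmetricAlgebra.ι F E (b 1) ^ i := by
    intro n
    induction n with
    | zero => intro x hx; exact ⟨0, le_rfl, by simpa using hx⟩
    | succ n ih =>
      intro x hx
      rw [pow_succ] at hx
      obtain ⟨y, hy, z, hz, rfl⟩ := Set.mem_mul.1 hx
      obtain ⟨i, hi, rfl⟩ := ih y hy
      rcases hz with rfl | hz
      · refine ⟨i, by omega, ?_⟩
        rw [Nat.succ_sub hi, pow_succ]; ring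
      · rw [Set.mem_singleton_iff] at hz
        subst hz
        refine ⟨i + 1, by omega, ?_⟩
        rw [Nat.succ_sub_succ, pow_succ]; ring
  rintro ⟨x, hx⟩ -
  have hx' := hx
  rw [SymPow, hr, Submodule.span_pow] at hx'
  have hle : Submodule.span F (({SymmetricAlgebra.ι F E (b 0), SymmetricAlgebra.ι F E (b 1)} :
        Set (SymmetricAlgebra F E)) ^ c) ≤
      (Submodule.span F (Set.range (fun i : Fin (c + 1) => monomial b c i))).map
        (SymPow F c E).subtype := by
    rw [Submodule.span_le]
    intro y hy
    obtain ⟨i, hi, rfl⟩ := hs c y hy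
    exact ⟨monomial b c i, Submodule.subset_span ⟨⟨i, Nat.lt_succ_of_le hi⟩, rfl⟩,
      by simp [monomial, hi]⟩
  obtain ⟨y, hy, hyx⟩ := hle hx'
  have : y = ⟨x, hx⟩ := Subtype.ext hyx
  exact this ▸ hy

/-- The basis `X^c, X^(c-1) Y, …, Y^c` of `Sym^c E`. -/
def symBasis (c : ℕ) : Module.Basis (Fin (c + 1)) F (SymPow F c E) :=
  Module.Basis.mk (monomial_linearIndependent b c) (monomial_span b c)

/-- `F_∧^(c)(i) = X^(c-i₁) Y^(i₁) ∧ ⋯ ∧ X^(c-i_r) Y^(i_r)`. -/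
def Fwedge (c : ℕ) {r : ℕ} (i : Fin r → ℕ) : ⋀[F]^r (SymPow F c E) :=
  exteriorPower.ιMulti F r fun a => monomial b c (i a)

/-- `F(i, j) = F_∧^(d)(i) ⊗ X^(d-j) Y^j`. -/
def Ftensor (d : ℕ) {N : ℕ} (i : Fin N → ℕ) (j : ℕ) :
    (⋀[F]^N (SymPow F d E)) ⊗[F] (SymPow F d E) :=
  Fwedge b d i ⊗ₜ[F] monomial b d j

/-- The box `B(k) = [k₁, k₂) × [k₂, k₃) × ⋯ × [k_N, k_{N+1})`. -/
def box {N : ℕ} (k : Fin (N + 1) → ℕ) : Finset (Fin N → ℕ) :=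
  Fintype.piFinset fun a => Finset.Ico (k a.castSucc) (k a.succ)

/-- The right-hand side `∑_{i ∈ B(k)} F(i, s + |k| - N - |i|)` of the definition of `φ`. -/
def phiValue (N d s : ℕ) (k : Fin (N + 1) → ℕ) :
    (⋀[F]^N (SymPow F d E)) ⊗[F] (SymPow F d E) :=
  ∑ i ∈ box k, Ftensor b d i (s + ∑ a, k a - N - ∑ a, i a)

/-- For `i` in the box, the exponents occurring in `phiValue` all lie in `{0, …, d}`, and the
subtractions are not truncated. -/
theorem exponent_le {N d s : ℕ} (hs : s + 1 ≤ N) {k : Fin (N + 1) → ℕ}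
    (hd : ∀ a, k a ≤ d + 1) {i : Fin N → ℕ} (hi : i ∈ box k) :
    (∀ a, i a ≤ d) ∧ N + ∑ a, i a ≤ s + ∑ a, k a ∧ s + ∑ a, k a - N - ∑ a, i a ≤ d := by
  simp only [box, Fintype.mem_piFinset, Finset.mem_Ico] at hi
  have h1 : ∑ a, (i a + 1) ≤ ∑ a : Fin N, k a.succ := Finset.sum_le_sum fun a _ => (hi a).2
  have h2 : ∑ a : Fin N, k a.castSucc ≤ ∑ a, i a := Finset.sum_le_sum fun a _ => (hi a).1
  have h3 := Fin.sum_univ_succ k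
  have h4 := Fin.sum_univ_castSucc k
  have h5 := hd (Fin.last N)
  rw [Finset.sum_add_distrib] at h1
  simp only [Finset.sum_const, Finset.card_univ, Fintype.card_fin, smul_eq_mul, mul_one] at h1
  refine ⟨fun a => ?_, ?_, ?_⟩
  · have := (hi a).2
    have := hd a.succ
    omega
  · omega
  · omega

/-- The linear map `φ : Sym^(N-1) E ⊗ ⋀^(N+1) Sym^(d+1) E → ⋀^N Sym^d E ⊗ Sym^d E`, defined on
the canonical basis by `φ (X^(N-1-s) Y^s ⊗ F_∧^(d+1)(k)) = ∑_{i ∈ B(k)} F(i, s + |k| - N - |i|)`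
for `0 ≤ s ≤ N-1` and `k` strictly increasing; see `phi_apply`. -/
def phi (N d : ℕ) :
    (SymPow F (N - 1) E) ⊗[F] (⋀[F]^(N + 1) (SymPow F (d + 1) E)) →ₗ[F]
      (⋀[F]^N (SymPow F d E)) ⊗[F] (SymPow F d E) :=
  ((symBasis b (N - 1)).tensorProduct ((symBasis b (d + 1)).exteriorPower (N + 1))).constr F
    fun p => phiValue b N d p.1 fun a => (Set.powersetCard.ofFinEmbEquiv.symm p.2 a : ℕ)

theorem phi_apply {N d s : ℕ} (hs : s ≤ N - 1) {k : Fin (N + 1) → ℕ} (hk : StrictMono k)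
    (hd : ∀ a, k a ≤ d + 1) :
    phi b N d (monomial b (N - 1) s ⊗ₜ[F] Fwedge b (d + 1) k) =
      ∑ i ∈ box k, Ftensor b d i (s + ∑ a, k a - N - ∑ a, i a) := by
  let k' : Fin (N + 1) ↪o Fin (d + 1 + 1) :=
    OrderEmbedding.ofStrictMono (fun a => ⟨k a, Nat.lt_succ_of_le (hd a)⟩) fun a a' h => hk h
  have e1 : monomial b (N - 1) s = symBasis b (N - 1) ⟨s, Nat.lt_succ_of_le hs⟩ := by
    rw [symBasis, Module.Basis.mk_apply]
  have e2 : Fwedge b (d + 1) k =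
      (symBasis b (d + 1)).exteriorPower (N + 1) (Set.powersetCard.ofFinEmbEquiv k') := by
    rw [exteriorPower.basis_apply, exteriorPower.ιMulti_family, Equiv.symm_apply_apply, Fwedge]
    congr 1
    funext a
    rw [Function.comp_apply, symBasis, Module.Basis.mk_apply]
    rfl
  rw [e1, e2, ← Module.Basis.tensorProduct_apply, phi, Module.Basis.constr_basis]
  simp only [Equiv.symm_apply_apply]
  rfl

end Phi

end Plethysm

end

/-! An element of `Sym^c E` is a homogeneous polynomial, so it has a value at a linear map `q : E →
R`; an element of `⋀^r Sym^c E` has a value at `r` points, by a determinant. Write `[q, p] = q(X)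
p(Y) - q(Y) p(X)`. In this model the box sum telescopes and `φ` becomes a division, `φ(g ⊗ f)(p₁, …,
p_N; q) = g(q) f(q, p₁, …, p_N) / ∏ [q, p_a]`, which is `tensorEval_phi_mul_prod` with the
denominator cleared. Evaluation at algebraically independent points is injective
(`wedgeEval_injective`, `tensorEval_wedgeEval_injective`), so the theorem can be read off from this
formula.

Equivariance (`phi_map`): a linear map `f` of `E` multiplies each of the `N` brackets by `det f`,
hence the twist by `det^N`.

Image (`phi_mem_Delta`): at points `z₀, …, z_N` the Laplace expansion of `μ_N (φ x)` is `∑ P(z_j) /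
∏_{i ≠ j} (z_j - z_i)`, where `P` is `x` with its `⋀^(N+1)` part evaluated at all the `z_i` and its
`Sym^(N-1)` variable left free. By Lagrange interpolation this sum is the coefficient of `t^N` in
`P`, and `deg P < N`.

Bijectivity: if `φ x = 0` then `P` vanishes at every `z_j`, so `x = 0` by a Vandermonde argument
(`phi_injective`). Since `μ_N` is onto, both sides have the same dimension. -/

noncomputable section

namespace Plethysm

/-! ### Evaluating symmetric and exterior powers at points. -/

section Evaluation

variable {F : Type*} [Field F] {R : Type*} [CommRing R] [Algebra F R]
  {E : Type*} [AddCommGroup E] [Module F E] {V : Type*} [AddCommGroup V] [Module F V]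
  {W : Type*} [AddCommGroup W] [Module F W]

/-- Evaluation of an element of `Sym^c E`, seen as a homogeneous polynomial, at a linear map
`p : E → R`: the linear map with `v₁ ⋯ v_c ↦ p v₁ ⋯ p v_c`. -/
def symEval (c : ℕ) (p : E →ₗ[F] R) : SymPow F c E →ₗ[F] R :=
  (SymmetricAlgebra.lift p).toLinearMap ∘ₗ (SymPow F c E).subtype

theorem symEval_monomial (b : Module.Basis (Fin 2) F E) (p : E →ₗ[F] R) {c i : ℕ} (h : i ≤ c) :
    symEval c p (monomial b c i) = p (b 0) ^ (c - i) * p (b 1) ^ i := by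
  simp [symEval, monomial, h]

theorem symEval_comp_symMap (c : ℕ) (p : E →ₗ[F] R) (f : E →ₗ[F] E) :
    symEval c p ∘ₗ symMap c f = symEval c (p ∘ₗ f) := by
  have h : (SymmetricAlgebra.lift p).comp
      (SymmetricAlgebra.lift (SymmetricAlgebra.ι F E ∘ₗ f)) =
        SymmetricAlgebra.lift (p ∘ₗ f) := by
    ext v; simp
  exact LinearMap.ext fun x => AlgHom.congr_fun h x.1

theorem symEval_comp (c : ℕ) (p : E →ₗ[F] R) {S : Type*} [CommRing S] [Algebra F S]
    (φ : R →ₐ[F] S) :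
    symEval c (φ.toLinearMap ∘ₗ p) = φ.toLinearMap ∘ₗ symEval c p := by
  have h : SymmetricAlgebra.lift (φ.toLinearMap ∘ₗ p) = φ.comp (SymmetricAlgebra.lift p) := by
    ext v; simp
  rw [symEval, h]; rfl

/-- The alternating form `(v₁, …, v_r) ↦ det (p_a (v_i))` attached to linear maps
`p₁, …, p_r : V → R`. -/
def detForm {r : ℕ} (p : Fin r → V →ₗ[F] R) : V [⋀^Fin r]→ₗ[F] R :=
  AlternatingMap.compLinearMap
    { (Matrix.detRowAlternating (R := R) (n := Fin r)).toMultilinearMap.restrictScalars F with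
      map_eq_zero_of_eq' := fun v _ _ h hne =>
        (Matrix.detRowAlternating (R := R) (n := Fin r)).map_eq_zero_of_eq v h hne }
    (LinearMap.pi p)

/-- The linear form `v₁ ∧ ⋯ ∧ v_r ↦ det (p_a (v_i))` on `⋀^r V`. -/
def wedgeEval {r : ℕ} (p : Fin r → V →ₗ[F] R) : ⋀[F]^r V →ₗ[F] R :=
  exteriorPower.alternatingMapLinearEquiv (detForm p)

theorem wedgeEval_ιMulti {r : ℕ} (p : Fin r → V →ₗ[F] R) (v : Fin r → V) :
    wedgeEval p (exteriorPower.ιMulti F r v) = (Matrix.of fun i a => p a (v i)).det := by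
  rw [wedgeEval, exteriorPower.alternatingMapLinearEquiv_apply_ιMulti]
  rfl

theorem wedgeEval_comp_map {r : ℕ} (p : Fin r → W →ₗ[F] R) (f : V →ₗ[F] W) :
    wedgeEval p ∘ₗ exteriorPower.map r f = wedgeEval fun a => p a ∘ₗ f := by
  ext v
  simp [wedgeEval_ιMulti, exteriorPower.map_apply_ιMulti]

theorem wedgeEval_symEval_map_symMap {r c : ℕ} (p : Fin r → E →ₗ[F] R) (f : E →ₗ[F] E) :
    (wedgeEval fun a => symEval c (p a)) ∘ₗ exteriorPower.map r (symMap c f) =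
      wedgeEval fun a => symEval c (p a ∘ₗ f) := by
  rw [wedgeEval_comp_map]
  simp only [symEval_comp_symMap]

/-- Determinants commute with ring homomorphisms; this allows points to be specialised from generic
ones. -/
theorem wedgeEval_comp {r : ℕ} (p : Fin r → V →ₗ[F] R) {S : Type*} [CommRing S] [Algebra F S]
    (φ : R →ₐ[F] S) :
    wedgeEval (fun a => φ.toLinearMap ∘ₗ p a) = φ.toLinearMap ∘ₗ wedgeEval p := by
  ext v
  simp only [LinearMap.compAlternatingMap_apply, wedgeEval_ιMulti, LinearMap.comp_apply,
    AlgHom.toLinearMap_apply, AlgHom.map_det]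
  rfl

/-- Moving the point `p_j` to the front changes `wedgeEval` by the sign `(-1)^j`. -/
theorem wedgeEval_cons_succAbove {r : ℕ} (p : Fin (r + 1) → V →ₗ[F] R) (j : Fin (r + 1)) :
    wedgeEval (Fin.cons (p j) fun a => p (j.succAbove a)) =
      ((-1) ^ (j : ℕ) : R) • wedgeEval p := by
  ext v
  simp only [LinearMap.compAlternatingMap_apply, wedgeEval_ιMulti, LinearMap.smul_apply,
    smul_eq_mul]
  rw [Matrix.det_succ_column _ 0, Matrix.det_succ_column _ j, Finset.mul_sum]
  refine Finset.sum_congr rfl fun i _ => ?_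
  have hs : ((-1 : R) ^ (j : ℕ)) * (-1) ^ (j : ℕ) = 1 := by
    rw [← mul_pow]; simp
  have hm : ((Matrix.of fun i a => (Fin.cons (p j) (fun a => p (j.succAbove a)) :
      Fin (r + 1) → V →ₗ[F] R) a (v i)).submatrix i.succAbove (Fin.succAbove 0)) =
      (Matrix.of fun i a => p a (v i)).submatrix i.succAbove j.succAbove := by
    ext k a
    simp
  rw [hm]
  simp only [Matrix.of_apply, Fin.cons_zero, Fin.val_zero, add_zero, pow_add]
  linear_combination (-(-1) ^ (i : ℕ) * p j (v i) *
    ((Matrix.of fun i a => p a (v i)).submatrix i.succAbove j.succAbove).det) * hs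

/-- The product `x ⊗ y ↦ f x * g y` of two `R`-valued linear maps. -/
def tensorEval (f : V →ₗ[F] R) (g : W →ₗ[F] R) : V ⊗[F] W →ₗ[F] R :=
  LinearMap.mul' F R ∘ₗ TensorProduct.map f g

@[simp]
theorem tensorEval_tmul (f : V →ₗ[F] R) (g : W →ₗ[F] R) (x : V) (y : W) :
    tensorEval f g (x ⊗ₜ[F] y) = f x * g y := by
  simp [tensorEval]

theorem tensorEval_smul_right (f : V →ₗ[F] R) (g : W →ₗ[F] R) (c : R) (x : V ⊗[F] W) :
    tensorEval f (c • g) x = c * tensorEval f g x := by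
  have h : tensorEval f (c • g) = c • tensorEval f g :=
    TensorProduct.ext' fun v w => by simp [mul_left_comm]
  rw [h, LinearMap.smul_apply, smul_eq_mul]

theorem tensorEval_map (f : V →ₗ[F] R) (g : W →ₗ[F] R) (f' : V →ₗ[F] V) (g' : W →ₗ[F] W)
    (x : V ⊗[F] W) :
    tensorEval f g (TensorProduct.map f' g' x) = tensorEval (f ∘ₗ f') (g ∘ₗ g') x := by
  rw [tensorEval, tensorEval, TensorProduct.map_comp]
  rfl

theorem mu_ιMulti_tmul (N : ℕ) (v : Fin N → V) (u : V) :
    mu F V N (exteriorPower.ιMulti F N v ⊗ₜ[F] u) =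
      exteriorPower.ιMulti F (N + 1) (Fin.snoc v u) := by
  apply Subtype.ext
  change ExteriorAlgebra.ιMulti F N v * ExteriorAlgebra.ι F u =
    ExteriorAlgebra.ιMulti F (N + 1) (Fin.snoc v u)
  rw [ExteriorAlgebra.ιMulti_apply, ExteriorAlgebra.ιMulti_apply, List.ofFn_succ',
    List.concat_eq_append, List.prod_append]
  simp only [Fin.snoc_castSucc, Fin.snoc_last, List.prod_singleton]

theorem mu_surjective (N : ℕ) : Function.Surjective (mu F V N) := by
  rw [← LinearMap.range_eq_top, eq_top_iff, ← exteriorPower.ιMulti_span, Submodule.span_le]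
  rintro _ ⟨v, rfl⟩
  exact ⟨exteriorPower.ιMulti F N (Fin.init v) ⊗ₜ[F] v (Fin.last N), by
    rw [mu_ιMulti_tmul, Fin.snoc_init_self]⟩

/-- Laplace expansion of the multiplication map `μ_N` along the last factor. -/
theorem wedgeEval_mu (N : ℕ) (p : Fin (N + 1) → V →ₗ[F] R) (w : (⋀[F]^N V) ⊗[F] V) :
    wedgeEval p (mu F V N w) =
      ∑ j : Fin (N + 1), (-1) ^ (N + j : ℕ) *
        tensorEval (wedgeEval fun a => p (j.succAbove a)) (p j) w := by
  have h : wedgeEval p ∘ₗ mu F V N = ∑ j : Fin (N + 1), ((-1) ^ (N + j : ℕ) : R) •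
      tensorEval (wedgeEval fun a => p (j.succAbove a)) (p j) := by
    apply TensorProduct.ext
    ext v u
    simp only [LinearMap.compAlternatingMap_apply, LinearMap.compr₂ₛₗ_apply,
      TensorProduct.mk_apply, LinearMap.comp_apply, mu_ιMulti_tmul, wedgeEval_ιMulti, LinearMap.sum_apply,
      LinearMap.smul_apply, tensorEval_tmul, smul_eq_mul]
    rw [Matrix.det_succ_row _ (Fin.last N)]
    refine Finset.sum_congr rfl fun j _ => ?_
    have hm : (Matrix.of fun i a => p a ((Fin.snoc v u : Fin (N + 1) → V) i)).submatrix
        (Fin.last N).succAbove j.succAbove = Matrix.of fun i a => p (j.succAbove a) (v i) := by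
      ext k a
      simp
    rw [hm]
    simp only [Matrix.of_apply, Fin.snoc_last, Fin.val_last]
    ring
  simpa using LinearMap.congr_fun h w

end Evaluation

/-! ### The quotient formula for `φ`. -/

section Quotient

variable {F : Type*} [Field F] {R : Type*} [CommRing R] [Algebra F R]
  {E : Type*} [AddCommGroup E] [Module F E] (b : Module.Basis (Fin 2) F E)

/-- The telescoping sum `∑_{k ≤ i < l} (t_{i+1} - t_i)` for
`t_i = x'^(d+1-i) y'^i x^(i-k) y^(l-i)`. -/
theorem sum_Ico_mul_bracket (x y x' y' : R) {d k l : ℕ} (hkl : k ≤ l) (hl : l ≤ d + 1) :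
    (∑ i ∈ Finset.Ico k l, x' ^ (d - i) * y' ^ i * (x ^ (i - k) * y ^ (l - 1 - i))) *
        (x * y' - y * x') =
      x ^ (l - k) * (x' ^ (d + 1 - l) * y' ^ l) - y ^ (l - k) * (x' ^ (d + 1 - k) * y' ^ k) := by
  rw [Finset.sum_mul]
  have h := Finset.sum_Ico_sub (fun i => x' ^ (d + 1 - i) * y' ^ i * (x ^ (i - k) * y ^ (l - i)))
    hkl
  simp only [Nat.sub_self, pow_zero, mul_one, one_mul] at h
  rw [mul_comm (x ^ (l - k)), mul_comm (y ^ (l - k)), ← h]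
  refine Finset.sum_congr rfl fun i hi => ?_
  obtain ⟨h1, h2⟩ := Finset.mem_Ico.1 hi
  obtain ⟨e, rfl⟩ := Nat.exists_eq_add_of_le h1
  obtain ⟨m, rfl⟩ : ∃ m, l = k + e + m + 1 := ⟨l - (k + e) - 1, by omega⟩
  obtain ⟨n, rfl⟩ : ∃ n, d = k + e + n := ⟨d - (k + e), by omega⟩
  rw [show k + e + n - (k + e) = n by omega, show k + e - k = e by omega,
    show k + e + m + 1 - 1 - (k + e) = m by omega, show k + e + n + 1 - (k + e + 1) = n by omega,
    show k + e + 1 - k = e + 1 by omega, show k + e + m + 1 - (k + e + 1) = m by omega,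
    show k + e + n + 1 - (k + e) = n + 1 by omega, show k + e + m + 1 - (k + e) = m + 1 by omega]
  ring

/-- Row reduction of the matrix of monomials of degree `D` at the points `(x, y)` and
`(x_a, y_a)`. -/
theorem det_monomial_cons [IsDomain R] {N D : ℕ} (x y : R) (hx : x ≠ 0) (x' y' : Fin N → R)
    {k : Fin (N + 1) → ℕ} (hk : StrictMono k) (hD : ∀ a, k a ≤ D) :
    x ^ (D - k (Fin.last N)) * y ^ k 0 * (Matrix.of fun i a : Fin N =>
        x ^ (k i.succ - k i.castSucc) * (x' a ^ (D - k i.succ) * y' a ^ k i.succ) -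
          y ^ (k i.succ - k i.castSucc) * (x' a ^ (D - k i.castSucc) * y' a ^ k i.castSucc)).det =
      (Matrix.of fun i a : Fin (N + 1) =>
        (Fin.cons x x' : Fin (N + 1) → R) a ^ (D - k i) *
          (Fin.cons y y' : Fin (N + 1) → R) a ^ k i).det := by
  set Z : Matrix (Fin N) (Fin N) R := Matrix.of fun i a : Fin N =>
        x ^ (k i.succ - k i.castSucc) * (x' a ^ (D - k i.succ) * y' a ^ k i.succ) -
          y ^ (k i.succ - k i.castSucc) * (x' a ^ (D - k i.castSucc) * y' a ^ k i.castSucc) with hZ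
  set M : Matrix (Fin (N + 1)) (Fin (N + 1)) R := Matrix.of fun i a =>
        (Fin.cons x x' : Fin (N + 1) → R) a ^ (D - k i) *
          (Fin.cons y y' : Fin (N + 1) → R) a ^ k i with hM
  have hle : ∀ i : Fin N, k i.castSucc ≤ k i.succ := fun i => (hk i.castSucc_lt_succ).le
  have hpow : ∀ i : Fin N, x ^ k i.succ = x ^ k i.castSucc * x ^ (k i.succ - k i.castSucc) := by
    intro i; rw [← pow_add, Nat.add_sub_cancel' (hle i)]
  set B : Matrix (Fin (N + 1)) (Fin (N + 1)) R := Matrix.of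
    (Fin.cons (fun a => x ^ k 0 * M 0 a)
      (fun i => Fin.cons 0 fun a => x ^ k i.castSucc * Z i a)) with hB
  -- Once row `i` is scaled by `x ^ k i`, column 0 has entries `x ^ D * y ^ k i`. Subtracting `y ^
  -- (k i.succ - k i.castSucc)` times the preceding row clears this column below its top entry and
  -- leaves a multiple of `Z` in the other columns.
  have h1 : (Matrix.of fun i a => x ^ k i * M i a).det = B.det := by
    refine Matrix.det_eq_of_forall_row_eq_smul_add_pred
      (fun i => y ^ (k i.succ - k i.castSucc)) (fun a => rfl) fun i a => ?_
    refine Fin.cases ?_ (fun a => ?_) a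
    · simp only [hB, hM, Matrix.of_apply, Fin.cons_succ, Fin.cons_zero, zero_add]
      rw [← mul_assoc, ← pow_add, ← mul_assoc (x ^ k i.castSucc), ← pow_add,
        Nat.add_sub_cancel' (hD _), Nat.add_sub_cancel' (hD _), mul_left_comm, ← pow_add,
        Nat.sub_add_cancel (hle i)]
    · simp only [hB, hM, hZ, Matrix.of_apply, Fin.cons_succ]
      rw [hpow]
      ring
  have h2 : B.det = x ^ k 0 * M 0 0 * ((∏ i : Fin N, x ^ k i.castSucc) * Z.det) := by
    rw [Matrix.det_succ_column_zero, Fin.sum_univ_succ]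
    have h0 : B.submatrix (Fin.succAbove 0) Fin.succ =
        Matrix.of fun i a => x ^ k i.castSucc * Z i a := by
      ext i a
      simp [hB]
    rw [h0, Matrix.det_mul_column]
    simp [hB]
  rw [Matrix.det_mul_column, h2, Fin.prod_univ_castSucc] at h1
  have hP : (∏ i : Fin N, x ^ k i.castSucc) ≠ 0 :=
    Finset.prod_ne_zero_iff.2 fun i _ => pow_ne_zero _ hx
  have hM0 : M 0 0 = x ^ (D - k 0) * y ^ k 0 := by simp [hM]
  have e1 : x ^ k 0 * x ^ (D - k 0) = x ^ D := by rw [← pow_add, Nat.add_sub_cancel' (hD _)]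
  have e2 : x ^ k (Fin.last N) * x ^ (D - k (Fin.last N)) = x ^ D := by
    rw [← pow_add, Nat.add_sub_cancel' (hD _)]
  -- The row scaling introduced the factor `∏ x ^ k i`, which is cancelled here.
  refine mul_left_cancel₀ (mul_ne_zero hP (pow_ne_zero (k (Fin.last N)) hx)) ?_
  rw [h1, hM0]
  linear_combination ((∏ i : Fin N, x ^ k i.castSucc) * y ^ k 0 * Z.det) * (e2 - e1)

/-- The factorisation of `x^(d-j) y^j`, where `j = s + |k| - N - |i|`, over the box. -/
theorem pow_exponent_eq (x y : R) {N d s : ℕ} (hs : s + 1 ≤ N) {k : Fin (N + 1) → ℕ}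
    (hd : ∀ a, k a ≤ d + 1) {i : Fin N → ℕ} (hi : i ∈ box k) :
    x ^ (d - (s + ∑ a, k a - N - ∑ a, i a)) * y ^ (s + ∑ a, k a - N - ∑ a, i a) =
      x ^ (N - 1 - s) * y ^ s * (x ^ (d + 1 - k (Fin.last N)) * y ^ k 0) *
        ∏ a, (x ^ (i a - k a.castSucc) * y ^ (k a.succ - 1 - i a)) := by
  obtain ⟨-, h1, h2⟩ := exponent_le hs hd hi
  simp only [box, Fintype.mem_piFinset, Finset.mem_Ico] at hi
  have hx : ∑ a : Fin N, (i a - k a.castSucc) + ∑ a : Fin N, k a.castSucc = ∑ a, i a := by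
    rw [← Finset.sum_add_distrib]
    exact Finset.sum_congr rfl fun a _ => Nat.sub_add_cancel (hi a).1
  have hy : ∑ a : Fin N, (k a.succ - 1 - i a) + ∑ a : Fin N, i a + N = ∑ a : Fin N, k a.succ := by
    have : ∑ a : Fin N, (k a.succ - 1 - i a) + ∑ a : Fin N, i a + ∑ a : Fin N, 1 =
        ∑ a : Fin N, k a.succ := by
      rw [← Finset.sum_add_distrib, ← Finset.sum_add_distrib]
      refine Finset.sum_congr rfl fun a _ => ?_
      have := (hi a).2
      omega
    simpa using this
  have h3 := Fin.sum_univ_succ k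
  have h4 := Fin.sum_univ_castSucc k
  have h5 := hd (Fin.last N)
  rw [Finset.prod_mul_distrib, Finset.prod_pow_eq_pow_sum, Finset.prod_pow_eq_pow_sum,
    show d - (s + ∑ a, k a - N - ∑ a, i a) = (N - 1 - s) + (d + 1 - k (Fin.last N)) +
      ∑ a : Fin N, (i a - k a.castSucc) by omega,
    show s + ∑ a, k a - N - ∑ a, i a = s + k 0 + ∑ a : Fin N, (k a.succ - 1 - i a) by omega]
  ring

/-- In the polynomial model, `φ (g ⊗ f) (p; q) = g(q) f(q, p) / ∏ (q₀ p_{a,1} - q₁ p_{a,0})`. -/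
theorem tensorEval_phiValue_mul_prod [IsDomain R] {N d s : ℕ} (hs : s + 1 ≤ N)
    {k : Fin (N + 1) → ℕ} (hk : StrictMono k) (hd : ∀ a, k a ≤ d + 1)
    (p : Fin N → E →ₗ[F] R) (q : E →ₗ[F] R) (hq : q (b 0) ≠ 0) :
    tensorEval (wedgeEval fun a => symEval d (p a)) (symEval d q) (phiValue b N d s k) *
        ∏ a, (q (b 0) * p a (b 1) - q (b 1) * p a (b 0)) =
      symEval (N - 1) q (monomial b (N - 1) s) *
        wedgeEval (fun a => symEval (d + 1) ((Fin.cons q p : Fin (N + 1) → E →ₗ[F] R) a))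
          (Fwedge b (d + 1) k) := by
  set x := q (b 0) with hx
  set y := q (b 1) with hy
  -- By `pow_exponent_eq` the weight of `i` in the box is a constant times a product over rows, and
  -- row `r` has its own range of summation. Multilinearity of the determinant then gathers the box
  -- sum into one determinant.
  have hsum : tensorEval (wedgeEval fun a => symEval d (p a)) (symEval d q)
      (phiValue b N d s k) = x ^ (N - 1 - s) * y ^ s * (x ^ (d + 1 - k (Fin.last N)) * y ^ k 0) *
        (Matrix.of fun r a : Fin N => ∑ i ∈ Finset.Ico (k r.castSucc) (k r.succ),
          p a (b 0) ^ (d - i) * p a (b 1) ^ i *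
            (x ^ (i - k r.castSucc) * y ^ (k r.succ - 1 - i))).det := by
    have hm := (Matrix.detRowAlternating (R := R) (n := Fin N)).toMultilinearMap.map_sum_finset
      (fun (r : Fin N) (i : ℕ) (a : Fin N) => p a (b 0) ^ (d - i) * p a (b 1) ^ i *
            (x ^ (i - k r.castSucc) * y ^ (k r.succ - 1 - i)))
      (fun r => Finset.Ico (k r.castSucc) (k r.succ))
    have hm' : (Matrix.of fun r a : Fin N => ∑ i ∈ Finset.Ico (k r.castSucc) (k r.succ),
          p a (b 0) ^ (d - i) * p a (b 1) ^ i *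
            (x ^ (i - k r.castSucc) * y ^ (k r.succ - 1 - i))).det =
        ∑ i ∈ box k, (Matrix.of fun r a : Fin N => (x ^ (i r - k r.castSucc) *
          y ^ (k r.succ - 1 - i r)) * (p a (b 0) ^ (d - i r) * p a (b 1) ^ i r)).det := by
      refine Eq.trans ?_ (hm.trans (Finset.sum_congr rfl fun i _ => ?_))
      · refine congrArg Matrix.det ?_
        ext r a
        simp
      · refine congrArg Matrix.det ?_
        ext r a
        exact mul_comm _ _
    rw [hm', phiValue, map_sum, Finset.mul_sum]
    refine Finset.sum_congr rfl fun i hi => ?_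
    obtain ⟨h0, h1, h2⟩ := exponent_le hs hd hi
    rw [Ftensor, tensorEval_tmul, symEval_monomial b q h2, Fwedge, wedgeEval_ιMulti,
      pow_exponent_eq _ _ hs hd hi]
    have hd' := Matrix.det_mul_column (fun r => x ^ (i r - k r.castSucc) *
          y ^ (k r.succ - 1 - i r))
      (Matrix.of fun r a : Fin N => p a (b 0) ^ (d - i r) * p a (b 1) ^ i r)
    simp only [Matrix.of_apply] at hd'
    rw [hd']
    simp only [symEval_monomial b _ (h0 _)]
    ring
  -- The `a`-th bracket is absorbed into column `a`, where every entry telescopes.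
  have hrow : (Matrix.of fun r a : Fin N => ∑ i ∈ Finset.Ico (k r.castSucc) (k r.succ),
          p a (b 0) ^ (d - i) * p a (b 1) ^ i *
            (x ^ (i - k r.castSucc) * y ^ (k r.succ - 1 - i))).det *
        ∏ a, (x * p a (b 1) - y * p a (b 0)) =
      (Matrix.of fun i a : Fin N =>
        x ^ (k i.succ - k i.castSucc) * (p a (b 0) ^ (d + 1 - k i.succ) * p a (b 1) ^ k i.succ) -
          y ^ (k i.succ - k i.castSucc) *
            (p a (b 0) ^ (d + 1 - k i.castSucc) * p a (b 1) ^ k i.castSucc)).det := by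
    rw [mul_comm, ← Matrix.det_mul_row]
    refine congrArg Matrix.det ?_
    ext r a
    simp only [Matrix.of_apply]
    rw [mul_comm, sum_Ico_mul_bracket _ _ _ _ (hk r.castSucc_lt_succ).le (hd _)]
  have hdet := det_monomial_cons x y hq (fun a => p a (b 0)) (fun a => p a (b 1)) hk hd
  rw [hsum, symEval_monomial b q (by omega), Fwedge, wedgeEval_ιMulti, mul_assoc, hrow, mul_assoc,
    hdet, ← hx, ← hy]
  congr 2
  ext i a
  refine Fin.cases ?_ (fun a => ?_) a <;> simp [symEval_monomial b _ (hd i), hx, hy]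

theorem symBasis_apply (c : ℕ) (i : Fin (c + 1)) : symBasis b c i = monomial b c i := by
  rw [symBasis, Module.Basis.mk_apply]

theorem exteriorPower_symBasis_apply (c r : ℕ) (K : Set.powersetCard (Fin (c + 1)) r) :
    (symBasis b c).exteriorPower r K =
      Fwedge b c fun a => (Set.powersetCard.ofFinEmbEquiv.symm K a : ℕ) := by
  rw [exteriorPower.basis_apply, exteriorPower.ιMulti_family, Fwedge]
  congr 1
  funext a
  rw [Function.comp_apply, symBasis_apply]

theorem linearMap_ext_monomial_tmul_Fwedge {c e r : ℕ} {M : Type*} [AddCommGroup M] [Module F M]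
    {f g : (SymPow F c E) ⊗[F] (⋀[F]^r (SymPow F e E)) →ₗ[F] M}
    (h : ∀ (s : ℕ) (k : Fin r → ℕ), s ≤ c → StrictMono k → (∀ a, k a ≤ e) →
      f (monomial b c s ⊗ₜ[F] Fwedge b e k) = g (monomial b c s ⊗ₜ[F] Fwedge b e k)) :
    f = g := by
  refine TensorProduct.ext ((symBasis b c).ext fun s => ((symBasis b e).exteriorPower r).ext
    fun K => ?_)
  rw [symBasis_apply, exteriorPower_symBasis_apply]
  exact h s _ (Nat.lt_succ_iff.1 s.2)
    (fun _ _ h => (Set.powersetCard.ofFinEmbEquiv.symm K).strictMono h)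
    (fun a => Nat.lt_succ_iff.1 (Set.powersetCard.ofFinEmbEquiv.symm K a).2)

theorem tensorEval_phi_mul_prod [IsDomain R] {N d : ℕ} (hN : 1 ≤ N)
    (p : Fin N → E →ₗ[F] R) (q : E →ₗ[F] R) (hq : q (b 0) ≠ 0)
    (x : (SymPow F (N - 1) E) ⊗[F] (⋀[F]^(N + 1) (SymPow F (d + 1) E))) :
    tensorEval (wedgeEval fun a => symEval d (p a)) (symEval d q) (phi b N d x) *
        ∏ a, (q (b 0) * p a (b 1) - q (b 1) * p a (b 0)) =
      tensorEval (symEval (N - 1) q)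
        (wedgeEval fun a => symEval (d + 1) ((Fin.cons q p : Fin (N + 1) → E →ₗ[F] R) a)) x := by
  have h : LinearMap.mulRight F (∏ a, (q (b 0) * p a (b 1) - q (b 1) * p a (b 0))) ∘ₗ
      tensorEval (wedgeEval fun a => symEval d (p a)) (symEval d q) ∘ₗ phi b N d =
      tensorEval (symEval (N - 1) q)
        (wedgeEval fun a => symEval (d + 1) ((Fin.cons q p : Fin (N + 1) → E →ₗ[F] R) a)) := by
    refine linearMap_ext_monomial_tmul_Fwedge b fun s k hs hk hd => ?_
    have key := tensorEval_phiValue_mul_prod b (show s + 1 ≤ N by omega) hk hd p q hq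
    rw [phiValue, ← phi_apply b hs hk hd] at key
    rw [tensorEval_tmul, ← key]
    rfl
  exact LinearMap.congr_fun h x

end Quotient

/-! ### Injectivity of evaluation at generic points. -/

section GenericPoints

variable {F : Type*} [Field F] {R : Type*} [CommRing R] [Algebra F R]
  {E : Type*} [AddCommGroup E] [Module F E] (b : Module.Basis (Fin 2) F E)
  {V : Type*} [AddCommGroup V] [Module F V]

/-- The affine point `X ↦ 1`, `Y ↦ z`. -/
def affinePoint (z : R) : E →ₗ[F] R :=
  b.constr F ![1, z]

@[simp]
theorem affinePoint_zero (z : R) : affinePoint b z (b 0) = 1 := by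
  simp [affinePoint]

@[simp]
theorem affinePoint_one (z : R) : affinePoint b z (b 1) = z := by
  simp [affinePoint]

theorem affinePoint_comp (z : R) {S : Type*} [CommRing S] [Algebra F S] (φ : R →ₐ[F] S) :
    φ.toLinearMap ∘ₗ affinePoint b z = affinePoint b (φ z) := by
  refine b.ext fun i => ?_
  fin_cases i <;> simp

theorem symEval_affinePoint_monomial (z : R) {c i : ℕ} (h : i ≤ c) :
    symEval c (affinePoint b z) (monomial b c i) = z ^ i := by
  simp [symEval_monomial b _ h]

/-- As a function of `z` the value is a polynomial whose coefficients come from the coordinates of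
`x` along the monomial basis. Interpolation and Vandermonde arguments rest on this. -/
theorem tensorEval_symEval_affinePoint_left (c : ℕ) (z : R) (f : V →ₗ[F] R)
    (x : (SymPow F c E) ⊗[F] V) :
    tensorEval (symEval c (affinePoint b z)) f x =
      ∑ s : Fin (c + 1), z ^ (s : ℕ) *
        f (TensorProduct.equivFinsuppOfBasisLeft (symBasis b c) x s) := by
  induction x using TensorProduct.induction_on with
  | zero => simp
  | add x y hx hy => simp only [map_add, Finsupp.add_apply, mul_add, Finset.sum_add_distrib, hx, hy]
  | tmul m v =>
    simp only [tensorEval_tmul, TensorProduct.equivFinsuppOfBasisLeft_apply_tmul_apply, map_smul]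
    conv_lhs => rw [← (symBasis b c).sum_repr m, map_sum, Finset.sum_mul]
    refine Finset.sum_congr rfl fun s _ => ?_
    rw [map_smul, symBasis_apply, symEval_affinePoint_monomial b z (Nat.lt_succ_iff.1 s.2),
      smul_mul_assoc, mul_smul_comm]

theorem tensorEval_symEval_affinePoint_right (c : ℕ) (z : R) (f : V →ₗ[F] R)
    (x : V ⊗[F] (SymPow F c E)) :
    tensorEval f (symEval c (affinePoint b z)) x =
      ∑ s : Fin (c + 1), f (TensorProduct.equivFinsuppOfBasisRight (symBasis b c) x s) *
        z ^ (s : ℕ) := by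
  induction x using TensorProduct.induction_on with
  | zero => simp
  | add x y hx hy => simp only [map_add, Finsupp.add_apply, add_mul, Finset.sum_add_distrib, hx, hy]
  | tmul v m =>
    simp only [tensorEval_tmul, TensorProduct.equivFinsuppOfBasisRight_apply_tmul_apply, map_smul]
    conv_lhs => rw [← (symBasis b c).sum_repr m, map_sum, Finset.mul_sum]
    refine Finset.sum_congr rfl fun s _ => ?_
    rw [map_smul, symBasis_apply, symEval_affinePoint_monomial b z (Nat.lt_succ_iff.1 s.2),
      smul_mul_assoc, mul_smul_comm]

/-- The coefficient of `X^l` in the alternant `det (X_a^(k_i))` for strictly increasing `k`, `l`. -/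
theorem coeff_det_X_pow {r : ℕ} {k l : Fin r → ℕ} (hk : StrictMono k) (hl : StrictMono l) :
    MvPolynomial.coeff (Finsupp.equivFunOnFinite.symm l)
      (Matrix.of fun i a : Fin r => (MvPolynomial.X a : MvPolynomial (Fin r) F) ^ k i).det =
        if k = l then 1 else 0 := by
  have hterm : ∀ σ : Equiv.Perm (Fin r), ∏ a, (Matrix.of fun i a : Fin r =>
      (MvPolynomial.X a : MvPolynomial (Fin r) F) ^ k i) (σ a) a =
        MvPolynomial.monomial (Finsupp.equivFunOnFinite.symm (k ∘ σ)) 1 := by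
    intro σ
    rw [MvPolynomial.monomial_eq, Finsupp.prod_fintype _ _ (by simp)]
    simp
  -- A strictly increasing tuple is determined by its set of values, so only the identity
  -- permutation can contribute.
  have hσ : ∀ σ : Equiv.Perm (Fin r), k ∘ σ = l → k = l ∧ σ = 1 := by
    intro σ h
    have hkl : k = l := by
      refine (hk.range_inj hl).1 ?_
      rw [← h, EquivLike.range_comp]
    refine ⟨hkl, Equiv.ext fun a => hk.injective ?_⟩
    exact (congrFun h a).trans (congrFun hkl a).symm
  rw [Matrix.det_apply, MvPolynomial.coeff_sum]
  simp only [hterm, Units.smul_def, MvPolynomial.coeff_smul, MvPolynomial.coeff_monomial,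
    EmbeddingLike.apply_eq_iff_eq]
  split_ifs with hkl
  · rw [Finset.sum_eq_single 1]
    · simp [hkl]
    · intro σ _ hne
      rw [if_neg fun h => hne (hσ σ h).2, smul_zero]
    · simp
  · refine Finset.sum_eq_zero fun σ _ => ?_
    rw [if_neg fun h => hkl (hσ σ h).1, smul_zero]

/-- Alternants have distinct leading exponents: the coordinate of `w` at `L` is the coefficient of
the monomial with exponents `l`. -/
theorem wedgeEval_X_injective (c r : ℕ) :
    Function.Injective (wedgeEval fun a : Fin r =>
      symEval c (affinePoint b (MvPolynomial.X a : MvPolynomial (Fin r) F))) := by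
  rw [injective_iff_map_eq_zero]
  intro w hw
  refine ((symBasis b c).exteriorPower r).forall_coord_eq_zero_iff.1 fun L => ?_
  set l : Fin r → ℕ := fun a => (Set.powersetCard.ofFinEmbEquiv.symm L a : ℕ) with hl
  have hcoord : ((symBasis b c).exteriorPower r).coord L =
      MvPolynomial.lcoeff F (Finsupp.equivFunOnFinite.symm l) ∘ₗ
        wedgeEval fun a : Fin r =>
          symEval c (affinePoint b (MvPolynomial.X a : MvPolynomial (Fin r) F)) := by
    refine ((symBasis b c).exteriorPower r).ext fun K => ?_
    rw [Module.Basis.coord_apply, Module.Basis.repr_self, LinearMap.comp_apply,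
      exteriorPower_symBasis_apply, Fwedge, wedgeEval_ιMulti]
    simp only [symEval_affinePoint_monomial b _
      (Nat.lt_succ_iff.1 (Set.powersetCard.ofFinEmbEquiv.symm K _).2)]
    refine Eq.trans ?_ (coeff_det_X_pow (F := F)
      (fun _ _ h => (Set.powersetCard.ofFinEmbEquiv.symm K).strictMono h)
      (fun _ _ h => (Set.powersetCard.ofFinEmbEquiv.symm L).strictMono h)).symm
    rw [Finsupp.single_apply]
    refine if_congr ⟨fun h => by rw [h], fun h => ?_⟩ rfl rfl
    refine Set.powersetCard.ofFinEmbEquiv.symm.injective (DFunLike.ext _ _ fun a => ?_)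
    exact Fin.ext (congrFun h a)
  rw [hcoord, LinearMap.comp_apply, hw, map_zero]

theorem wedgeEval_injective (c : ℕ) {r : ℕ} {z : Fin r → R} (hz : AlgebraicIndependent F z) :
    Function.Injective (wedgeEval fun a => symEval c (affinePoint b (z a))) := by
  have h : (wedgeEval fun a => symEval c (affinePoint b (z a))) =
      (MvPolynomial.aeval z).toLinearMap ∘ₗ wedgeEval fun a : Fin r =>
        symEval c (affinePoint b (MvPolynomial.X a : MvPolynomial (Fin r) F)) := by
    rw [← wedgeEval_comp]
    simp only [← symEval_comp, affinePoint_comp, MvPolynomial.aeval_X]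
  rw [h, LinearMap.coe_comp]
  exact Function.Injective.comp hz (wedgeEval_X_injective b c r)

/-- The last point is the polynomial variable, so the coefficient of `X ^ s` isolates the `s`-th
coordinate, to which `wedgeEval_injective` applies. -/
theorem tensorEval_wedgeEval_injective (c : ℕ) {r : ℕ} {z : Fin r → R}
    (hz : AlgebraicIndependent F z) :
    Function.Injective (tensorEval
      (wedgeEval fun a => symEval c (affinePoint b (Polynomial.C (z a))))
      (symEval c (affinePoint b (Polynomial.X : Polynomial R)))) := by
  rw [injective_iff_map_eq_zero]
  intro w hw
  have hC : (wedgeEval fun a => symEval c (affinePoint b (Polynomial.C (z a)))) =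
      (Polynomial.CAlgHom (R := F)).toLinearMap ∘ₗ
        wedgeEval fun a => symEval c (affinePoint b (z a)) := by
    rw [← wedgeEval_comp]
    simp only [← symEval_comp, affinePoint_comp, Polynomial.CAlgHom_apply]
  rw [tensorEval_symEval_affinePoint_right, hC] at hw
  refine (TensorProduct.equivFinsuppOfBasisRight (symBasis b c)).map_eq_zero_iff.1
    (Finsupp.ext fun s => wedgeEval_injective b c hz ?_)
  have := congrArg (fun P => Polynomial.coeff P (s : ℕ)) hw
  simp only [LinearMap.comp_apply, AlgHom.toLinearMap_apply, Polynomial.CAlgHom_apply,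
    Polynomial.finsetSum_coeff, Polynomial.coeff_C_mul_X_pow, Polynomial.coeff_zero,
    Fin.val_inj] at this
  simpa using this

theorem affinePoint_X_ne_zero [Nontrivial R] {v : E} (hv : v ≠ 0) :
    affinePoint b (Polynomial.X : Polynomial R) v ≠ 0 := by
  intro h
  apply hv
  have hv' : affinePoint b (Polynomial.X : Polynomial R) v =
      Polynomial.C (algebraMap F R (b.repr v 0)) +
        Polynomial.C (algebraMap F R (b.repr v 1)) * Polynomial.X := by
    conv_lhs => rw [← b.sum_repr v, Fin.sum_univ_two]
    simp [Algebra.smul_def, Polynomial.algebraMap_apply]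
  rw [hv'] at h
  refine b.repr.map_eq_zero_iff.1 (Finsupp.ext fun i => (algebraMap F R).injective ?_)
  fin_cases i
  · simpa using congrArg (fun P => Polynomial.coeff P 0) h
  · simpa using congrArg (fun P => Polynomial.coeff P 1) h

end GenericPoints

/-! ### Equivariance of `φ`. -/

section Isomorphism

variable {F : Type*} [Field F] {E : Type*} [AddCommGroup E] [Module F E]
  (b : Module.Basis (Fin 2) F E)

/-- The bracket is an alternating form on the plane `E`, so it scales by the determinant. -/
theorem bracket_comp {R : Type*} [CommRing R] [Algebra F R] (p q : E →ₗ[F] R) (f : E →ₗ[F] E) :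
    q (f (b 0)) * p (f (b 1)) - q (f (b 1)) * p (f (b 0)) =
      algebraMap F R (LinearMap.det f) * (q (b 0) * p (b 1) - q (b 1) * p (b 0)) := by
  have hf : ∀ j, f (b j) =
      LinearMap.toMatrix b b f 0 j • b 0 + LinearMap.toMatrix b b f 1 j • b 1 := by
    intro j
    conv_lhs => rw [← b.sum_repr (f (b j)), Fin.sum_univ_two]
    simp [LinearMap.toMatrix_apply]
  rw [← LinearMap.det_toMatrix b, Matrix.det_fin_two, hf 0, hf 1]
  simp only [map_add, map_smul, map_sub, map_mul, Algebra.smul_def]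
  ring

theorem tensorEval_symEval_wedgeEval_map {R : Type*} [CommRing R] [Algebra F R] {c e r : ℕ}
    (f : E →ₗ[F] E) (p : Fin r → E →ₗ[F] R) (q : E →ₗ[F] R)
    (x : (SymPow F c E) ⊗[F] (⋀[F]^r (SymPow F e E))) :
    tensorEval (symEval c q) (wedgeEval fun a => symEval e (p a))
        (TensorProduct.map (symMap c f) (exteriorPower.map r (symMap e f)) x) =
      tensorEval (symEval c (q ∘ₗ f)) (wedgeEval fun a => symEval e (p a ∘ₗ f)) x := by
  refine (tensorEval_map _ _ _ _ x).trans ?_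
  rw [symEval_comp_symMap, wedgeEval_symEval_map_symMap]

theorem tensorEval_wedgeEval_symEval_map {R : Type*} [CommRing R] [Algebra F R] {c e r : ℕ}
    (f : E →ₗ[F] E) (p : Fin r → E →ₗ[F] R) (q : E →ₗ[F] R)
    (x : (⋀[F]^r (SymPow F e E)) ⊗[F] (SymPow F c E)) :
    tensorEval (wedgeEval fun a => symEval e (p a)) (symEval c q)
        (TensorProduct.map (exteriorPower.map r (symMap e f)) (symMap c f) x) =
      tensorEval (wedgeEval fun a => symEval e (p a ∘ₗ f)) (symEval c (q ∘ₗ f)) x := by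
  refine (tensorEval_map _ _ _ _ x).trans ?_
  rw [symEval_comp_symMap, wedgeEval_symEval_map_symMap]

/-- The quotient formula is used at `(p, q)` for the transformed tensor and at `(p ∘ f, q ∘ f)` for
`x`. The numerators agree, while the denominators differ by `det f ^ N`. -/
theorem tensorEval_phi_map_mul_prod {R : Type*} [CommRing R] [IsDomain R] [Algebra F R]
    {N d : ℕ} (hN : 1 ≤ N) (f : E →ₗ[F] E) (p : Fin N → E →ₗ[F] R) (q : E →ₗ[F] R)
    (hq : q (b 0) ≠ 0) (hqf : q (f (b 0)) ≠ 0)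
    (x : (SymPow F (N - 1) E) ⊗[F] (⋀[F]^(N + 1) (SymPow F (d + 1) E))) :
    tensorEval (wedgeEval fun a => symEval d (p a)) (symEval d q)
        (phi b N d (TensorProduct.map (symMap (N - 1) f)
          (exteriorPower.map (N + 1) (symMap (d + 1) f)) x)) *
        ∏ a, (q (b 0) * p a (b 1) - q (b 1) * p a (b 0)) =
      algebraMap F R (LinearMap.det f ^ N) *
        tensorEval (wedgeEval fun a => symEval d (p a)) (symEval d q)
          (TensorProduct.map (exteriorPower.map N (symMap d f)) (symMap d f) (phi b N d x)) *
        ∏ a, (q (b 0) * p a (b 1) - q (b 1) * p a (b 0)) := by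
  have hcons : (Fin.cons (q ∘ₗ f) fun a => p a ∘ₗ f : Fin (N + 1) → E →ₗ[F] R) =
      fun a => (Fin.cons q p : Fin (N + 1) → E →ₗ[F] R) a ∘ₗ f := by
    funext a
    refine Fin.cases ?_ (fun a => ?_) a <;> simp
  have hprod : ∏ a, ((q ∘ₗ f) (b 0) * (p a ∘ₗ f) (b 1) - (q ∘ₗ f) (b 1) * (p a ∘ₗ f) (b 0)) =
      algebraMap F R (LinearMap.det f) ^ N *
        ∏ a, (q (b 0) * p a (b 1) - q (b 1) * p a (b 0)) := by
    simp only [LinearMap.comp_apply, bracket_comp b, Finset.prod_mul_distrib, Finset.prod_const,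
      Finset.card_univ, Fintype.card_fin]
  have hcomm : ∀ s t : R, s * (algebraMap F R (LinearMap.det f) ^ N * t) =
      algebraMap F R (LinearMap.det f ^ N) * s * t := by
    intro s t
    rw [map_pow]
    ring
  have h := tensorEval_phi_mul_prod b hN (fun a => p a ∘ₗ f) (q ∘ₗ f) hqf x
  rw [hprod, hcons] at h
  refine (tensorEval_phi_mul_prod b hN p q hq _).trans
    ((tensorEval_symEval_wedgeEval_map f (Fin.cons q p) q x).trans (h.symm.trans ?_))
  refine Eq.trans ?_ (congrArg (fun t => algebraMap F R (LinearMap.det f ^ N) * t *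
    ∏ a, (q (b 0) * p a (b 1) - q (b 1) * p a (b 0)))
    (tensorEval_wedgeEval_symEval_map f p q (phi b N d x)).symm)
  exact hcomm _ _

theorem phi_map {N d : ℕ} (hN : 1 ≤ N) (f : E →ₗ[F] E) (hf : Function.Injective f)
    (x : (SymPow F (N - 1) E) ⊗[F] (⋀[F]^(N + 1) (SymPow F (d + 1) E))) :
    phi b N d (TensorProduct.map (symMap (N - 1) f)
        (exteriorPower.map (N + 1) (symMap (d + 1) f)) x) =
      LinearMap.det f ^ N • TensorProduct.map (exteriorPower.map N (symMap d f)) (symMap d f)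
        (phi b N d x) := by
  have hb : b 0 ≠ 0 := b.ne_zero 0
  have key := tensorEval_phi_map_mul_prod b hN f
    (fun a => affinePoint b (Polynomial.C (MvPolynomial.X a : MvPolynomial (Fin N) F)))
    (affinePoint b Polynomial.X) (affinePoint_X_ne_zero b hb)
    (affinePoint_X_ne_zero b fun h => hb (hf (h.trans (map_zero f).symm))) x
  apply tensorEval_wedgeEval_injective b d (MvPolynomial.algebraicIndependent_X (Fin N) F)
  rw [map_smul, Algebra.smul_def]
  -- Each bracket is `C (X a) - X`, whose coefficient of degree 1 is `-1`.
  refine mul_right_cancel₀ (Finset.prod_ne_zero_iff.2 fun a _ h => ?_) key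
  have := congrArg (fun P => Polynomial.coeff P 1) h
  simp at this

/-! ### The image lies in the kernel of `μ_N`. -/

theorem prod_erase_eq_prod_succAbove {M : Type*} [CommMonoid M] {N : ℕ} (j : Fin (N + 1))
    (f : Fin (N + 1) → M) :
    ∏ i ∈ Finset.univ.erase j, f i = ∏ a : Fin N, f (j.succAbove a) := by
  rw [← Finset.compl_singleton, ← Fin.image_succAbove_univ,
    Finset.prod_image fun _ _ _ _ h => Fin.succAbove_right_injective h]

/-- Moving `z j` back from the front to position `j` costs the sign. The exterior factor is then the
same for all `j`, and only the symmetric factor depends on the chosen point. -/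
theorem tensorEval_phi_succAbove_mul_prod {R : Type*} [CommRing R] [IsDomain R] [Algebra F R]
    {N d : ℕ} (hN : 1 ≤ N) (z : Fin (N + 1) → R) (j : Fin (N + 1))
    (x : (SymPow F (N - 1) E) ⊗[F] (⋀[F]^(N + 1) (SymPow F (d + 1) E))) :
    tensorEval (wedgeEval fun a => symEval d (affinePoint b (z (j.succAbove a))))
        (symEval d (affinePoint b (z j))) (phi b N d x) * ∏ a, (z (j.succAbove a) - z j) =
      (-1) ^ (j : ℕ) * tensorEval (symEval (N - 1) (affinePoint b (z j)))
        (wedgeEval fun a => symEval (d + 1) (affinePoint b (z a))) x := by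
  have h := tensorEval_phi_mul_prod b hN (fun a => affinePoint b (z (j.succAbove a)))
    (affinePoint b (z j)) (by simp) x
  simp only [affinePoint_zero, affinePoint_one, one_mul, mul_one] at h
  have hcons : (fun a => symEval (d + 1) ((Fin.cons (affinePoint b (z j))
        fun a => affinePoint b (z (j.succAbove a)) : Fin (N + 1) → E →ₗ[F] R) a)) =
      Fin.cons (symEval (d + 1) (affinePoint b (z j)))
        fun a => symEval (d + 1) (affinePoint b (z (j.succAbove a))) := by
    funext a
    refine Fin.cases ?_ (fun a => ?_) a <;> simp
  rw [h, hcons, wedgeEval_cons_succAbove (fun a => symEval (d + 1) (affinePoint b (z a))) j,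
    tensorEval_smul_right]

theorem algebraicIndependent_algebraMap_X (F : Type*) [Field F] (r : ℕ) :
    AlgebraicIndependent F fun a : Fin r =>
      algebraMap (MvPolynomial (Fin r) F) (FractionRing (MvPolynomial (Fin r) F))
        (MvPolynomial.X a) :=
  (MvPolynomial.algebraicIndependent_X (Fin r) F).map'
    (f := IsScalarTower.toAlgHom F (MvPolynomial (Fin r) F) (FractionRing (MvPolynomial (Fin r) F)))
    (IsFractionRing.injective _ _)

theorem exists_polynomial_eval_eq {K : Type*} [Field K] [Algebra F K] {V : Type*}
    [AddCommGroup V] [Module F V] {N : ℕ} (hN : 1 ≤ N) (g : V →ₗ[F] K)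
    (x : (SymPow F (N - 1) E) ⊗[F] V) :
    ∃ P : Polynomial K, P.degree < N ∧
      ∀ t, tensorEval (symEval (N - 1) (affinePoint b t)) g x = P.eval t := by
  refine ⟨∑ s : Fin (N - 1 + 1), Polynomial.C
    (g (TensorProduct.equivFinsuppOfBasisLeft (symBasis b (N - 1)) x s)) *
      Polynomial.X ^ (s : ℕ), ?_, fun t => ?_⟩
  · refine (Polynomial.degree_sum_le _ _).trans_lt ((Finset.sup_lt_iff ?_).2 fun s _ => ?_)
    · exact WithBot.bot_lt_coe N
    · refine (Polynomial.degree_C_mul_X_pow_le _ _).trans_lt ?_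
      have := s.2
      exact_mod_cast (show (s : ℕ) < N by omega)
  · rw [tensorEval_symEval_affinePoint_left]
    simp only [Polynomial.eval_finsetSum, Polynomial.eval_mul, Polynomial.eval_C,
      Polynomial.eval_pow, Polynomial.eval_X]
    exact Finset.sum_congr rfl fun s _ => mul_comm _ _

/-- After the sign `(-1) ^ N` turns `∏ (z_i - z_j)` around, the terms are `P(z_j) / ∏ (z_j - z_i)`.
Their sum is the degree `N` coefficient of `P`. -/
theorem sum_eq_zero_of_mul_prod_eq_eval {K : Type*} [Field K] {N : ℕ} {z : Fin (N + 1) → K}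
    (hz : Function.Injective z) {P : Polynomial K} (hP : P.degree < N) (T : Fin (N + 1) → K)
    (hT : ∀ j, T j * ∏ a, (z (j.succAbove a) - z j) = (-1) ^ (j : ℕ) * P.eval (z j)) :
    ∑ j : Fin (N + 1), (-1) ^ (N + j : ℕ) * T j = 0 := by
  have hL := Lagrange.coeff_eq_sum (s := Finset.univ) (v := z) hz.injOn (P := P)
    (hP.trans (by simpa using (by exact_mod_cast Nat.lt_succ_self N : (N : WithBot ℕ) < N + 1)))
  rw [Finset.card_univ, Fintype.card_fin, Nat.add_sub_cancel,
    Polynomial.coeff_eq_zero_of_degree_lt hP] at hL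
  rw [hL]
  refine Finset.sum_congr rfl fun j _ => ?_
  have hne : ∏ a, (z j - z (j.succAbove a)) ≠ 0 :=
    Finset.prod_ne_zero_iff.2 fun a _ h =>
      Fin.succAbove_ne j a (hz (sub_eq_zero.1 h)).symm
  have hprod : ∏ a, (z (j.succAbove a) - z j) = (-1) ^ N * ∏ a, (z j - z (j.succAbove a)) := by
    simp_rw [← neg_sub (z j)]
    rw [Finset.prod_neg, Finset.card_univ, Fintype.card_fin]
  have h := hT j
  rw [hprod] at h
  have hj : ((-1 : K) ^ (j : ℕ)) * (-1) ^ (j : ℕ) = 1 := by rw [← mul_pow]; simp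
  rw [prod_erase_eq_prod_succAbove, eq_div_iff hne, pow_add]
  linear_combination (-1) ^ (j : ℕ) * h + P.eval (z j) * hj

theorem wedgeEval_mu_phi {K : Type*} [Field K] [Algebra F K] {N d : ℕ} (hN : 1 ≤ N)
    {z : Fin (N + 1) → K} (hz : Function.Injective z)
    (x : (SymPow F (N - 1) E) ⊗[F] (⋀[F]^(N + 1) (SymPow F (d + 1) E))) :
    wedgeEval (fun a => symEval d (affinePoint b (z a))) (mu F _ N (phi b N d x)) = 0 := by
  obtain ⟨P, hP, heval⟩ := exists_polynomial_eval_eq b hN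
    (wedgeEval fun a => symEval (d + 1) (affinePoint b (z a))) x
  rw [wedgeEval_mu]
  refine sum_eq_zero_of_mul_prod_eq_eval hz hP _ fun j => ?_
  rw [← heval]
  exact tensorEval_phi_succAbove_mul_prod b hN z j x

theorem phi_mem_Delta {N d : ℕ} (hN : 1 ≤ N)
    (x : (SymPow F (N - 1) E) ⊗[F] (⋀[F]^(N + 1) (SymPow F (d + 1) E))) :
    phi b N d x ∈ Delta F (SymPow F d E) N := by
  have hz := algebraicIndependent_algebraMap_X F (N + 1)
  refine wedgeEval_injective b d hz ?_
  rw [wedgeEval_mu_phi b hN hz.injective, map_zero]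

/-! ### Injectivity and dimension count. -/

theorem phi_injective {N d : ℕ} (hN : 1 ≤ N) : Function.Injective (phi b N d) := by
  rw [injective_iff_map_eq_zero]
  intro x hx
  have hz := MvPolynomial.algebraicIndependent_X (Fin (N + 1)) F
  refine (TensorProduct.equivFinsuppOfBasisLeft (symBasis b (N - 1))).map_eq_zero_iff.1
    (Finsupp.ext fun s => wedgeEval_injective b (d + 1) hz ?_)
  rw [Finsupp.zero_apply, map_zero]
  -- There are `N - 1 + 1 = N` unknown coefficients, so the first `N` of the `N + 1` points already
  -- give an invertible Vandermonde system.
  refine congrFun (Matrix.eq_zero_of_forall_index_sum_pow_mul_eq_zero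
    (f := fun j : Fin (N - 1 + 1) =>
      (MvPolynomial.X (Fin.castLE (by omega) j) : MvPolynomial (Fin (N + 1)) F))
    (v := fun s => (wedgeEval fun a => symEval (d + 1) (affinePoint b (MvPolynomial.X a)))
      (TensorProduct.equivFinsuppOfBasisLeft (symBasis b (N - 1)) x s))
    (fun i j h => Fin.castLE_injective _ (hz.injective h)) fun j => ?_) s
  have h := tensorEval_phi_succAbove_mul_prod b hN
    (fun a => (MvPolynomial.X a : MvPolynomial (Fin (N + 1)) F)) (Fin.castLE (by omega) j) x
  rw [hx, map_zero, zero_mul, tensorEval_symEval_affinePoint_left] at h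
  exact (mul_eq_zero.1 h.symm).resolve_left (pow_ne_zero _ (neg_ne_zero.2 one_ne_zero))

theorem finrank_symPow (b : Module.Basis (Fin 2) F E) (c : ℕ) :
    Module.finrank F (SymPow F c E) = c + 1 := by
  rw [Module.finrank_eq_card_basis (symBasis b c), Fintype.card_fin]

theorem finrank_Delta {V : Type*} [AddCommGroup V] [Module F V] [Module.Finite F V] (N : ℕ) :
    (Module.finrank F V).choose (N + 1) + Module.finrank F (Delta F V N) =
      (Module.finrank F V).choose N * Module.finrank F V := by
  have h := LinearMap.finrank_range_add_finrank_ker (V := (⋀[F]^N V) ⊗[F] V) (mu F V N)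
  rwa [LinearMap.range_eq_top.2 (mu_surjective N), finrank_top, Module.finrank_tensorProduct,
    exteriorPower.finrank_eq, exteriorPower.finrank_eq] at h

/-- With `d + 1` in place of `d`, this matches the source dimension with rank–nullity for `μ_N`. -/
theorem mul_choose_add_choose (N d : ℕ) :
    N * (d + 1).choose (N + 1) + d.choose (N + 1) = d.choose N * d := by
  have h1 := Nat.choose_succ_right_eq d N
  rw [Nat.choose_succ_succ]
  rcases le_or_gt N d with hle | hlt
  · obtain ⟨e, rfl⟩ := Nat.exists_eq_add_of_le hle
    rw [Nat.add_sub_cancel_left] at h1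
    linear_combination h1
  · rw [Nat.choose_eq_zero_of_lt hlt, Nat.choose_eq_zero_of_lt (hlt.trans (Nat.lt_succ_self N))]
    simp

theorem finrank_symPow_tensor_exteriorPower (b : Module.Basis (Fin 2) F E) {N d : ℕ}
    (hN : 1 ≤ N) :
    Module.finrank F ((SymPow F (N - 1) E) ⊗[F] (⋀[F]^(N + 1) (SymPow F (d + 1) E))) =
      Module.finrank F (Delta F (SymPow F d E) N) := by
  have : ∀ c, Module.Finite F (SymPow F c E) := fun c => Module.Finite.of_basis (symBasis b c)
  have h := finrank_Delta (F := F) (V := SymPow F d E) N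
  rw [finrank_symPow b, ← mul_choose_add_choose] at h
  rw [Module.finrank_tensorProduct, exteriorPower.finrank_eq, finrank_symPow b, finrank_symPow b,
    Nat.sub_add_cancel hN]
  omega

theorem finite_submodule {A : Type*} [AddCommMonoid A] [Module F A] [Module.Finite F A]
    (S : Submodule F A) : Module.Finite F S := by
  let _ := Module.addCommMonoidToAddCommGroup F (M := A)
  infer_instance

/-- Only additive monoids are assumed; negation is recovered as multiplication by `-1`. -/
theorem bijective_of_injective_of_finrank_eq {A B : Type*} [AddCommMonoid A] [Module F A]
    [AddCommMonoid B] [Module F B] [Module.Finite F A] [Module.Finite F B] (f : A →ₗ[F] B)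
    (hf : Function.Injective f) (h : Module.finrank F A = Module.finrank F B) :
    Function.Bijective f := by
  let _ := Module.addCommMonoidToAddCommGroup F (M := A)
  let _ := Module.addCommMonoidToAddCommGroup F (M := B)
  exact (LinearMap.linearEquivOfInjective f hf h).bijective

theorem phi_codRestrict_bijective {N d : ℕ} (hN : 1 ≤ N) :
    Function.Bijective
      ((phi b N d).codRestrict (Delta F (SymPow F d E) N) (phi_mem_Delta b hN)) := by
  have (c : ℕ) : Module.Finite F (SymPow F c E) := Module.Finite.of_basis (symBasis b c)
  have := finite_submodule (Delta F (SymPow F d E) N)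
  exact bijective_of_injective_of_finrank_eq _
    (fun _ _ h => phi_injective b hN (congrArg Subtype.val h))
    (finrank_symPow_tensor_exteriorPower b hN)

theorem det_natRep (g : GL (Fin 2) F) :
    LinearMap.det (natRep F g) = (g : Matrix (Fin 2) (Fin 2) F).det :=
  LinearMap.det_toLin' (g : Matrix (Fin 2) (Fin 2) F)

/-- The identification `F ⊗ D ≃ D` turns the scalar `det ^ N` in `he` into the action on the first
tensor factor. -/
theorem exists_equiv_detRep_tprod_subrepresentation {A C : Type*} [AddCommMonoid A] [Module F A]
    [AddCommMonoid C] [Module F C] {N : ℕ} {ρ : Representation F (GL (Fin 2) F) A}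
    {σ : Representation F (GL (Fin 2) F) C} {D : Submodule F C}
    (hD : ∀ g, D ≤ D.comap (σ g)) (f : A →ₗ[F] C) (hf : ∀ x, f x ∈ D)
    (hbij : Function.Bijective (f.codRestrict D hf))
    (he : ∀ g x, f (ρ g x) = LinearMap.det (natRep F g) ^ N • σ g (f x)) :
    ∃ Φ : Representation.Equiv ρ ((detRep F N).tprod (σ.subrepresentation D hD)),
      ∀ x, Φ x = (1 : F) ⊗ₜ[F] (⟨f x, hf x⟩ : D) := by
  let e : A ≃ₗ[F] D := LinearEquiv.ofBijective _ hbij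
  refine ⟨Representation.Equiv.mk (e.trans (TensorProduct.lid F D).symm) fun g =>
    LinearMap.ext fun x => ?_, fun x => rfl⟩
  have h : e (ρ g x) = (g : Matrix (Fin 2) (Fin 2) F).det ^ N •
      σ.subrepresentation D hD g (e x) :=
    Subtype.ext ((he g x).trans (by rw [det_natRep]; rfl))
  change (1 : F) ⊗ₜ[F] e (ρ g x) =
    TensorProduct.map (detRep F N g) (σ.subrepresentation D hD g) ((1 : F) ⊗ₜ[F] e x)
  rw [TensorProduct.map_tmul, h, TensorProduct.tmul_smul, TensorProduct.smul_tmul']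
  rfl

end Isomorphism

end Plethysm

end

theorem corollary3p1 {F : Type*} [Field F] (b : Module.Basis (Fin 2) F (Fin 2 → F))
    (N d : ℕ) (hN : 1 ≤ N) :
    ∃ h : ∀ x, Plethysm.phi b N d x ∈ Plethysm.Delta F (Plethysm.SymPow F d (Fin 2 → F)) N,
      ∃ Φ : Representation.Equiv
          ((Plethysm.symRep (N - 1) (Plethysm.natRep F)).tprod
            (Plethysm.extRep (N + 1) (Plethysm.symRep (d + 1) (Plethysm.natRep F))))
          ((Plethysm.detRep F N).tprod
            (Plethysm.deltaRep N (Plethysm.symRep d (Plethysm.natRep F)))),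
        ∀ x, Φ x = (1 : F) ⊗ₜ[F] ⟨Plethysm.phi b N d x, h x⟩ := by
  exact ⟨Plethysm.phi_mem_Delta b hN, Plethysm.exists_equiv_detRep_tprod_subrepresentation
    (Plethysm.Delta_le_comap N _) (Plethysm.phi b N d) (Plethysm.phi_mem_Delta b hN)
    (Plethysm.phi_codRestrict_bijective b hN) fun g x => Plethysm.phi_map b hN
      (Plethysm.natRep F g) ((Plethysm.natRep F).apply_bijective g).injective x⟩
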